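/- Let $d\ge 2$ and $t\ge 0$ be integers, and let $\mathcal G_d$ be the class of finite connected simple $d$-regular graphs. For $k\ge 0$ let $N(d,k)=1+\sum_{j=0}^{k-1}d(d-1)^j$, and let $[R]=\{1,\dots,R\}$. **Tasks.** A labeled star with labels in $\mathcal L$ is the star with center $p_0$ and leaves $p_1,\dots,p_d$, each of whose nodes carries a label in $\mathcal L$; labeled stars are considered up to isomorphism (that is, up to permuting the leaves). A simplicial complex is a family of nonempty finite sets closed under taking nonempty subsets, and its facets are its maximal simplices. An LCL task $T$ consists of finite label sets $\mathcal L_{in},\mathcal L_{out}$, sets $\mathcal S_{in},\mathcal S_{out}$ of labeled stars with labels in $\mathcal L_{in}$ and $\mathcal L_{out}$ respectively, and a map $\Delta$. The input complex $\mathcal I_d$ (resp. the output complex $\mathcal O_d$) is the complex whose facets are the sets $\{(p_i,x_i):0\le i\le d\}$ such that the star in which each $p_i$ has label $x_i$ is in $\mathcal S_{in}$ (resp. $\mathcal S_{out}$), and $\Delta$ maps every facet of $\mathcal I_d$ to a set of facets of $\mathcal O_d$ (the legal ones). **Algorithms.** Let $\mathcal G\subseteq\mathcal G_d$. An instance is a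 graph $G\in\mathcal G$ with pairwise distinct positive integers as IDs of its nodes (from an arbitrarily large range), and input labels in $\mathcal L_{in}$ such that every labeled star of $G$ (a node with its $d$ neighbors) is in $\mathcal S_{in}$. The view of a node $v$ after $t$ rounds is the ball of radius $t$ centered at $v$, with the IDs and the input labels of its nodes; it contains the nodes at distance at most $t$ from $v$ and the edges with an endpoint at distance less than $t$. A $t$-round algorithm in the LOCAL model is a function from such views to $\mathcal L_{out}$. It solves $T$ on $\mathcal G$ if, for every instance and every star of $G$ with center $v_0$ and leaves $v_1,\dots,v_d$ (listed in any order), the outputs $y_i$ of the $v_i$ form a star in $\mathcal S_{out}$ and $\{(p_i,y_i)\}\in\Delta(\{(p_i,x_i)\})$, where $x_i$ is the input label of $v_i$. **Local complexes.** Views $w_0,\dots,w_d$ are mutually compatible if there are an instance and a star in it, with center $v_0$ and leaves $v_1,\dots,v_d$, such that $w_i$ is the view of $v_i$ after $t$ rounds for every $i$. Let $\mathcal I_{d,[R]}$ be the complex whose facets are the sets $\{(p_i,(\mathrm{id}_i,x_i)):0\le i\le d\}$ with pairwise distinct $\mathrm{id}_i\in[R]$ and $\{(p_i,x_i):0\le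 i\le d\}$ a facet of $\mathcal I_d$; let $\pi(p_i,(\mathrm{id},x))=(p_i,x)$. The protocol complex $\mathcal P^{(t)}_{d,[R]}$ is the complex whose facets are the sets $\{(p_i,w_i):0\le i\le d\}$ such that $w_0,\dots,w_d$ are mutually compatible views in which all IDs are in $[R]$. For a facet $F=\{(p_i,(\mathrm{id}_i,x_i))\}$ of $\mathcal I_{d,[R]}$, $\Xi_t(F)$ is the set of all facets $\{(p_i,w_i)\}$ of $\mathcal P^{(t)}_{d,[R]}$ such that, for every $i$, the center of $w_i$ has ID $\mathrm{id}_i$ and input label $x_i$. A simplicial map $\delta:\mathcal P^{(t)}_{d,[R]}\to\mathcal O_d$ is name-preserving if $\delta(p_i,w)$ is always of the form $(p_i,y)$, and name-independent if this $y$ depends only on $w$ and not on $p_i$. Such a map is called a decision map for IDs in $[R]$ if it is simplicial, name-preserving and name-independent and if $\delta(\Xi_t(F))\subseteq\Delta(\pi(F))$ for every facet $F$ of $\mathcal I_{d,[R]}$. **Theorem.** 1. For every $\mathcal G\subseteq\mathcal G_d$ and every LCL task $T$: if some $t$-round algorithm in the LOCAL model solves $T$ on $\mathcal G$, then for every $R\ge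 N(d,t+1)$ there is a decision map $\delta:\mathcal P^{(t)}_{d,[R]}\to\mathcal O_d$ for IDs in $[R]$. 2. For all integers $a,b\ge 0$ there is $R\ge N(d,t+1)$, depending only on $d,t,a,b$, such that for every $\mathcal G\subseteq\mathcal G_d$ and every LCL task $T$ with $|\mathcal L_{in}|=a$ and $|\mathcal L_{out}|=b$: if there is a decision map $\delta:\mathcal P^{(t)}_{d,[R]}\to\mathcal O_d$ for IDs in $[R]$, then some $t$-round algorithm in the LOCAL model solves $T$ on $\mathcal G$. -/

import Mathlib

open scoped Classical

universe u v

noncomputable section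

namespace LocalLCL

/-! ### Simplicial complexes

Complexes are Mathlib's `PreAbstractSimplicialComplex`: a collection of nonempty finite sets that is
closed under taking nonempty subsets. -/

/-- The facets of a complex: its simplices that are maximal for inclusion. -/
def facets {α : Type*} (K : PreAbstractSimplicialComplex α) : Set (Finset α) :=
  {s | Maximal (fun r => r ∈ K.faces) s}

/-- The complex generated by a family of finite sets: all their nonempty subsets. -/
def generated {α : Type*} (𝓕 : Set (Finset α)) : PreAbstractSimplicialComplex α where
  faces := {s | s.Nonempty ∧ ∃ F ∈ 𝓕, s ⊆ F}
  isRelLowerSet_faces := by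
    rintro s ⟨hs, F, hF, hsF⟩
    exact ⟨hs, fun r hr hne => ⟨hne, F, hF, hr.trans hsF⟩⟩

/-- A map on vertices is simplicial if it maps simplices to simplices. -/
def IsSimplicial {α β : Type*} (K : PreAbstractSimplicialComplex α)
    (L : PreAbstractSimplicialComplex β) (f : α → β) : Prop :=
  ∀ s ∈ K.faces, s.image f ∈ L.faces

/-- The set `{(p_i, x_i) : i ∈ {0, …, d}}`, where the name `p_i` is represented by `i`. -/
def named {d : ℕ} {α : Type*} (x : Fin (d + 1) → α) : Finset (Fin (d + 1) × α) :=
  Finset.univ.image fun i => (i, x i)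

/-- A map on vertices `(p, w)` of a complex is name-preserving if `(p, w)` is mapped to some
`(p, y)`. -/
def IsNamePreserving {d : ℕ} {α β : Type*} (K : PreAbstractSimplicialComplex (Fin (d + 1) × α))
    (f : Fin (d + 1) × α → Fin (d + 1) × β) : Prop :=
  ∀ i w, {(i, w)} ∈ K.faces → (f (i, w)).1 = i

/-- A map on vertices `(p, w)` of a complex is name-independent if the value that it gives to
`(p, w)` does not depend on the name `p`. -/
def IsNameIndependent {d : ℕ} {α β : Type*} (K : PreAbstractSimplicialComplex (Fin (d + 1) × α))
    (f : Fin (d + 1) × α → Fin (d + 1) × β) : Prop :=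
  ∀ i j w, {(i, w)} ∈ K.faces → {(j, w)} ∈ K.faces → (f (i, w)).2 = (f (j, w)).2

/-! ### Graphs, stars and LCL tasks -/

/-- The class of all finite connected simple `d`-regular graphs. A finite graph is taken, up to
isomorphism, on the vertex set `Fin n`. -/
def regularGraphs (d : ℕ) : Set (Σ n : ℕ, SimpleGraph (Fin n)) :=
  {G | G.2.Connected ∧ G.2.IsRegularOfDegree d}

/-- The isomorphism classes of labelings of the star with `d` leaves: the label of the center, and
the multiset of the `d` labels of the leaves. -/
abbrev LabeledStar (d : ℕ) (L : Type*) : Type _ := L × Sym L d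

/-- The labeled star obtained by giving label `x 0` to the center `p_0` and `x i` to the leaf
`p_i`. -/
def starOf {d : ℕ} {L : Type*} (x : Fin (d + 1) → L) : LabeledStar d L :=
  (x 0, ⟨Finset.univ.val.map (fun i : Fin d => x i.succ), by simp⟩)

/-- `v 0, …, v d` are the nodes of a star of `G` with `d` leaves that is centered at `v 0`. -/
def IsStar {V : Type*} (G : SimpleGraph V) {d : ℕ} (v : Fin (d + 1) → V) : Prop :=
  Function.Injective v ∧ ∀ i : Fin d, G.Adj (v 0) (v i.succ)

/-- All the stars (with `d` leaves) of `G`, labeled by `x`, belong to `S`. -/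
def StarsIn {V : Type*} (G : SimpleGraph V) {d : ℕ} {L : Type*} (S : Set (LabeledStar d L))
    (x : V → L) : Prop :=
  ∀ v : Fin (d + 1) → V, IsStar G v → starOf (x ∘ v) ∈ S

/-- The complex whose facets are the sets `{(p_i, x_i) : i ∈ {0, …, d}}` such that the labeled star
defined by the `x_i` is in `S`. -/
def starComplex {d : ℕ} {L : Type*} (S : Set (LabeledStar d L)) :
    PreAbstractSimplicialComplex (Fin (d + 1) × L) :=
  generated {F | ∃ x : Fin (d + 1) → L, starOf x ∈ S ∧ F = named x}

/-- An LCL task for `d`-regular graphs: the good input stars, the good output stars, and the map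
`Δ` that specifies, for every facet of the input complex, which facets of the output complex are
legal. (If the task has no input-output constraint then `Δ F` consists of all the facets of the
output complex.) -/
structure LCLTask (d : ℕ) (Lin : Type u) (Lout : Type v) where
  /-- the good input stars -/
  Sin : Set (LabeledStar d Lin)
  /-- the good output stars -/
  Sout : Set (LabeledStar d Lout)
  /-- the legal output facets, for each input facet -/
  Δ : Finset (Fin (d + 1) × Lin) → Set (Finset (Fin (d + 1) × Lout))
  Δ_subset : ∀ F ∈ facets (starComplex Sin), Δ F ⊆ facets (starComplex Sout)

namespace LCLTask

variable {d : ℕ} {Lin : Type u} {Lout : Type v}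

/-- The input complex. -/
def inputComplex (T : LCLTask d Lin Lout) : PreAbstractSimplicialComplex (Fin (d + 1) × Lin) :=
  starComplex T.Sin

/-- The output complex. -/
def outputComplex (T : LCLTask d Lin Lout) : PreAbstractSimplicialComplex (Fin (d + 1) × Lout) :=
  starComplex T.Sout

end LCLTask

/-! ### The LOCAL model -/

/-- An assignment of identifiers: pairwise distinct positive integers, in an arbitrary range. -/
def IsIdAssignment {V : Type*} (ident : V → ℕ) : Prop :=
  Function.Injective ident ∧ ∀ v, 1 ≤ ident v

/-- A view: a ball whose nodes carry input labels in `L` and pairwise distinct identifiers. As the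
identifiers determine the nodes, the isomorphism class of such a ball is recorded by the identifier
of the center, the pairs (identifier, label) of the nodes, and the pairs of identifiers that are
joined by an edge. -/
@[ext]
structure View (L : Type u) where
  /-- the identifier of the center -/
  center : ℕ
  /-- the nodes, given by their identifiers and labels -/
  nodes : Set (ℕ × L)
  /-- the edges, between identifiers -/
  edges : Set (Sym2 ℕ)

/-- The view of node `v` after `t` rounds in the connected graph `G` with identifiers `ident` and
input labels `x`: the ball of radius `t` around `v`. What `v` learns in `t` rounds are the nodes at
distance at most `t` and the edges with an endpoint at distance less than `t`; an edge that joins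
two nodes at distance exactly `t` cannot be learned in `t` rounds. -/
def view {V : Type*} {L : Type u} (G : SimpleGraph V) (ident : V → ℕ) (x : V → L) (t : ℕ) (v : V) :
    View L where
  center := ident v
  nodes := {p | ∃ a, G.dist v a ≤ t ∧ p = (ident a, x a)}
  edges := {e | ∃ a b, G.Adj a b ∧ G.dist v a < t ∧ e = s(ident a, ident b)}

/-- A `t`-round algorithm in the LOCAL model is a function `alg` from views to output labels. It
solves the task `T` on the class `𝒢` if, for every graph of `𝒢`, all identifiers, and all input
labels for which every star is a good input star, the outputs are such that every star is a good
output star and that, for every star of the graph (with its leaves listed in any order), the output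
facet is legal for the input facet. -/
def Solves {d : ℕ} {Lin : Type u} {Lout : Type v} (𝒢 : Set (Σ n : ℕ, SimpleGraph (Fin n)))
    (T : LCLTask d Lin Lout) (t : ℕ) (alg : View Lin → Lout) : Prop :=
  ∀ G ∈ 𝒢, ∀ (ident : Fin G.1 → ℕ) (x : Fin G.1 → Lin),
    IsIdAssignment ident → StarsIn G.2 T.Sin x →
      StarsIn G.2 T.Sout (fun v => alg (view G.2 ident x t v)) ∧
      ∀ v : Fin (d + 1) → Fin G.1, IsStar G.2 v →
        named (fun i => alg (view G.2 ident x t (v i))) ∈ T.Δ (named (x ∘ v))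

/-- The task `T` is solvable in `t` rounds in the LOCAL model on the class `𝒢`. -/
def SolvableInLOCAL {d : ℕ} {Lin : Type u} {Lout : Type v}
    (𝒢 : Set (Σ n : ℕ, SimpleGraph (Fin n))) (T : LCLTask d Lin Lout) (t : ℕ) : Prop :=
  ∃ alg : View Lin → Lout, Solves 𝒢 T t alg

/-! ### Local complexes with identifiers -/

/-- `N(d, k) = 1 + d + d(d-1) + ⋯ + d(d-1)^(k-1)`, for `d ≥ 1`. -/
def ballBound (d k : ℕ) : ℕ := 1 + ∑ j ∈ Finset.range k, d * (d - 1) ^ j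

/-- `w_0, …, w_d` are mutually compatible views at distance `t`: they are the views of the nodes of
a star, centered at the first of them, in some graph of `𝒢` with some identifiers and some good
input labels. -/
def MutuallyCompatible {d : ℕ} {Lin : Type u} (𝒢 : Set (Σ n : ℕ, SimpleGraph (Fin n)))
    (Sin : Set (LabeledStar d Lin)) (t : ℕ) (w : Fin (d + 1) → View Lin) : Prop :=
  ∃ G ∈ 𝒢, ∃ (ident : Fin G.1 → ℕ) (x : Fin G.1 → Lin) (v : Fin (d + 1) → Fin G.1),
    IsIdAssignment ident ∧ StarsIn G.2 Sin x ∧ IsStar G.2 v ∧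
      ∀ i, w i = view G.2 ident x t (v i)

namespace LCLTask

variable {d : ℕ} {Lin : Type u} {Lout : Type v}

/-- The input complex extended with (pairwise distinct) identifiers in `X`. -/
def inputComplexWithIds (T : LCLTask d Lin Lout) (X : Finset ℕ) :
    PreAbstractSimplicialComplex (Fin (d + 1) × (ℕ × Lin)) :=
  generated {F | ∃ y : Fin (d + 1) → ℕ × Lin,
    Function.Injective (fun i => (y i).1) ∧ (∀ i, (y i).1 ∈ X) ∧
    starOf (fun i => (y i).2) ∈ T.Sin ∧ F = named y}

/-- The `t`-round protocol complex for identifiers in `X`: its facets are the sets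
`{(p_i, w_i) : i ∈ {0, …, d}}` where `w_0, …, w_d` are mutually compatible views at distance `t`, in
which all the identifiers are in `X`. -/
def protocolComplex (T : LCLTask d Lin Lout) (𝒢 : Set (Σ n : ℕ, SimpleGraph (Fin n))) (t : ℕ)
    (X : Finset ℕ) : PreAbstractSimplicialComplex (Fin (d + 1) × View Lin) :=
  generated {F | ∃ w : Fin (d + 1) → View Lin,
    MutuallyCompatible 𝒢 T.Sin t w ∧ (∀ i, ∀ p ∈ (w i).nodes, p.1 ∈ X) ∧ F = named w}

/-- The set `Ξ_t(F)` of the facets of the protocol complex that may result from the facet `F` of the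
input complex with identifiers: the center of the view of `p_i` has the identifier and the input
label of `p_i` in `F`, for every `i`. -/
def Ξ (T : LCLTask d Lin Lout) (𝒢 : Set (Σ n : ℕ, SimpleGraph (Fin n))) (t : ℕ) (X : Finset ℕ)
    (F : Finset (Fin (d + 1) × (ℕ × Lin))) : Set (Finset (Fin (d + 1) × View Lin)) :=
  {F' | F' ∈ facets (T.protocolComplex 𝒢 t X) ∧
    ∀ i y, (i, y) ∈ F → ∃ w, (i, w) ∈ F' ∧ w.center = y.1 ∧ y ∈ w.nodes}

end LCLTask

/-- The map `π` on vertices, which removes the identifiers: `π(p_i, (id, x)) = (p_i, x)`. -/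
def forgetIds {d : ℕ} {Lin : Type u} : Fin (d + 1) × (ℕ × Lin) → Fin (d + 1) × Lin :=
  fun p => (p.1, p.2.2)

/-- There is a name-independent and name-preserving simplicial map `δ` from the `t`-round protocol
complex with identifiers in `X` to the output complex, such that `δ(Ξ_t(F)) ⊆ Δ(π(F))` for every
facet `F` of the input complex with identifiers in `X`. -/
def HasDecisionMap {d : ℕ} {Lin : Type u} {Lout : Type v}
    (𝒢 : Set (Σ n : ℕ, SimpleGraph (Fin n))) (T : LCLTask d Lin Lout) (t : ℕ) (X : Finset ℕ) :
    Prop :=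
  ∃ δ : Fin (d + 1) × View Lin → Fin (d + 1) × Lout,
    IsSimplicial (T.protocolComplex 𝒢 t X) T.outputComplex δ ∧
    IsNamePreserving (T.protocolComplex 𝒢 t X) δ ∧
    IsNameIndependent (T.protocolComplex 𝒢 t X) δ ∧
    ∀ F ∈ facets (T.inputComplexWithIds X),
      (fun F' : Finset (Fin (d + 1) × View Lin) => F'.image δ) '' T.Ξ 𝒢 t X F ⊆
        T.Δ (F.image forgetIds)

end LocalLCL

end

open LocalLCL

/-!
One direction is immediate: a `t`-round algorithm `alg` yields the map `(p, w) ↦ (p, alg w)`, and a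
facet of `Ξ_t(F)` consists of the views of a star whose identifiers and inputs are those of `F`.

For the other direction, a decision map for identifiers in `[R]` is a function `D` from views to
outputs, by name-independence, and it has to be extended to views with arbitrary identifiers. By
Ramsey's theorem (`exists_color_eq_of_card_eq`), if `R` is large then there is a large `X ⊆ [R]` such
that the value of `D` at a view with identifiers in `X` depends only on the relative order of these
identifiers (`exists_orderInvariant`): the color of a set `A` of identifiers is the table of the
values of `D` at all the views obtained by distributing `A` increasingly over a pattern of bounded
size, and the number of tables depends only on the numbers of labels and on that size. The algorithm
replaces the identifiers of a view by elements of `X`, in an order-preserving way, and applies `D`.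

It is correct at a star centered at `v₀` because the views of the nodes of the star all lie in the
ball of radius `t + 1` around `v₀`, whose size is bounded. Hence the identifiers of that ball can be
replaced at once, by an increasing map `ψ` with values in `X`, and the nodes outside the ball can get
any identifiers greater than `R`. In this new instance the views of the star form a facet of the
protocol complex, and `D` has the same values at them as the algorithm has at the original views, by
order invariance.
-/

namespace LocalLCL

/-! ### Ramsey's theorem for finite sets of integers -/

/-- Ramsey's theorem for `r`-subsets, by induction on `r`. -/
theorem exists_monochromatic (K : Type*) [Finite K] (r m : ℕ) :
    ∃ R : ℕ, ∀ S : Finset ℕ, R ≤ S.card → ∀ c : Finset ℕ → K, ∃ X ⊆ S, X.card = m ∧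
      ∀ A ⊆ X, ∀ B ⊆ X, A.card = r → B.card = r → c A = c B := by
  induction r generalizing m with
  | zero =>
    refine ⟨m, fun S hS c => ?_⟩
    obtain ⟨X, hX, hXm⟩ := Finset.exists_subset_card_eq hS
    refine ⟨X, hX, hXm, fun A _ B _ hA hB => ?_⟩
    rw [Finset.card_eq_zero.1 hA, Finset.card_eq_zero.1 hB]
  | succ r ih =>
    -- In a suitable large set, the color of an `(r + 1)`-subset depends only on its minimum.
    have key : ∀ n : ℕ, ∃ R : ℕ, ∀ S : Finset ℕ, R ≤ S.card → ∀ c : Finset ℕ → K,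
        ∃ Y ⊆ S, Y.card = n ∧ ∃ g : ℕ → K, ∀ A ⊆ Y, A.card = r + 1 →
          ∀ a ∈ A, (∀ b ∈ A, a ≤ b) → c A = g a := by
      intro n
      induction n with
      | zero =>
        refine ⟨0, fun S _ c => ⟨∅, by simp, by simp, fun _ => c ∅, ?_⟩⟩
        intro A hA _ a ha
        exact absurd (hA ha) (by simp)
      | succ n ihn =>
        obtain ⟨Rn, hRn⟩ := ihn
        obtain ⟨R', hR'⟩ := ih Rn
        refine ⟨R' + 1, fun S hS c => ?_⟩
        have hne : S.Nonempty := Finset.card_pos.1 (by omega)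
        obtain ⟨x, hxS, hxmin⟩ : ∃ x ∈ S, ∀ b ∈ S, x ≤ b :=
          ⟨S.min' hne, S.min'_mem hne, fun b hb => S.min'_le b hb⟩
        obtain ⟨Z, hZS, hZ, hZc⟩ := hR' (S.erase x)
          (by rw [Finset.card_erase_of_mem hxS]; omega) (fun A => c (insert x A))
        obtain ⟨Y, hYZ, hY, g, hg⟩ := hRn Z hZ.ge c
        obtain ⟨k, hk⟩ : ∃ k, ∀ A ⊆ Z, A.card = r → c (insert x A) = k := by
          by_cases h : ∃ A ⊆ Z, A.card = r
          · obtain ⟨A₀, hA₀, hA₀r⟩ := h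
            exact ⟨c (insert x A₀), fun A hA hAr => hZc A hA A₀ hA₀ hAr hA₀r⟩
          · exact ⟨c ∅, fun A hA hAr => absurd ⟨A, hA, hAr⟩ h⟩
        have hYS : Y ⊆ S.erase x := hYZ.trans hZS
        have hxY : x ∉ Y := fun h => Finset.notMem_erase x S (hYS h)
        have hins : insert x Y ⊆ S :=
          Finset.insert_subset hxS (hYS.trans (Finset.erase_subset _ _))
        refine ⟨insert x Y, hins, by rw [Finset.card_insert_of_notMem hxY, hY],
          Function.update g x k, fun A hA hAr a ha hmin => ?_⟩
        by_cases hxA : x ∈ A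
        · obtain rfl : a = x := le_antisymm (hmin x hxA) (hxmin a (hins (hA ha)))
          rw [Function.update_self, ← Finset.insert_erase ha]
          refine hk _ (fun b hb => hYZ ?_) (by rw [Finset.card_erase_of_mem ha, hAr]; rfl)
          rw [Finset.mem_erase] at hb
          exact (Finset.mem_insert.1 (hA hb.2)).resolve_left hb.1
        · rw [Function.update_of_ne (ne_of_mem_of_not_mem ha hxA)]
          exact hg A ((Finset.subset_insert_iff_of_notMem hxA).1 hA) hAr a ha hmin
    have := Fintype.ofFinite K
    obtain ⟨R, hR⟩ := key (Fintype.card K * m)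
    refine ⟨R, fun S hS c => ?_⟩
    obtain ⟨Y, hYS, hY, g, hg⟩ := hR S hS c
    obtain ⟨k, -, hk⟩ := Finset.exists_le_card_fiber_of_mul_le_card_of_maps_to
      (s := Y) (t := Finset.univ) (f := g) (n := m) (fun _ _ => Finset.mem_univ _)
      ⟨c ∅, Finset.mem_univ _⟩ (by rw [hY]; rfl)
    obtain ⟨X, hX, hXm⟩ := Finset.exists_subset_card_eq hk
    have hcol : ∀ A ⊆ X, A.card = r + 1 → c A = k := by
      intro A hA hAr
      have hne : A.Nonempty := Finset.card_pos.1 (by omega)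
      rw [hg A (hA.trans (hX.trans (Finset.filter_subset _ _))) hAr (A.min' hne)
        (A.min'_mem hne) (fun b hb => A.min'_le b hb)]
      exact (Finset.mem_filter.1 (hX (hA (A.min'_mem hne)))).2
    exact ⟨X, hX.trans ((Finset.filter_subset _ _).trans hYS), hXm,
      fun A hA B hB hAr hBr => (hcol A hA hAr).trans (hcol B hB hBr).symm⟩

/-- Ramsey's theorem, for the subsets of all sizes simultaneously. -/
theorem exists_color_eq_of_card_eq (K : Type*) [Finite K] (m : ℕ) :
    ∃ R : ℕ, ∀ S : Finset ℕ, R ≤ S.card → ∀ c : Finset ℕ → K, ∃ X ⊆ S, X.card = m ∧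
      ∀ A ⊆ X, ∀ B ⊆ X, A.card = B.card → c A = c B := by
  have key : ∀ s m : ℕ, ∃ R : ℕ, ∀ S : Finset ℕ, R ≤ S.card → ∀ c : Finset ℕ → K,
      ∃ X ⊆ S, X.card = m ∧ ∀ A ⊆ X, ∀ B ⊆ X, A.card < s → A.card = B.card → c A = c B := by
    intro s
    induction s with
    | zero =>
      refine fun m => ⟨m, fun S hS c => ?_⟩
      obtain ⟨X, hX, hXm⟩ := Finset.exists_subset_card_eq hS
      exact ⟨X, hX, hXm, fun A _ B _ h => absurd h (Nat.not_lt_zero _)⟩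
    | succ s ih =>
      intro m
      obtain ⟨R₁, hR₁⟩ := exists_monochromatic K s m
      obtain ⟨R, hR⟩ := ih R₁
      refine ⟨R, fun S hS c => ?_⟩
      obtain ⟨Y, hYS, hY, hYc⟩ := hR S hS c
      obtain ⟨X, hXY, hX, hXc⟩ := hR₁ Y hY.ge c
      refine ⟨X, hXY.trans hYS, hX, fun A hA B hB hs hAB => ?_⟩
      rcases Nat.lt_succ_iff_lt_or_eq.1 hs with h | h
      · exact hYc A (hA.trans hXY) B (hB.trans hXY) h hAB
      · exact hXc A hA B hB h (hAB ▸ h)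
  obtain ⟨R, hR⟩ := key (m + 1) m
  refine ⟨R, fun S hS c => ?_⟩
  obtain ⟨X, hXS, hX, hXc⟩ := hR S hS c
  exact ⟨X, hXS, hX, fun A hA B hB h =>
    hXc A hA B hB (Nat.lt_succ_of_le (hX ▸ Finset.card_le_card hA)) h⟩

/-! ### Increasing maps between finite sets of integers -/

theorem exists_strictMonoOn_mapsTo (B X : Finset ℕ) (h : B.card ≤ X.card) :
    ∃ ψ : ℕ → ℕ, StrictMonoOn ψ (B : Set ℕ) ∧ ∀ i ∈ B, ψ i ∈ X := by
  refine ⟨fun i => if hi : i ∈ B then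
    X.orderEmbOfFin rfl (Fin.castLE h ((B.orderIsoOfFin rfl).symm ⟨i, hi⟩)) else 0, ?_, ?_⟩
  · intro i hi j hj hij
    rw [Finset.mem_coe] at hi hj
    simpa only [hi, hj, dif_pos, OrderEmbedding.lt_iff_lt, Fin.castLE_lt_castLE_iff,
      OrderIso.lt_iff_lt, Subtype.mk_lt_mk] using hij
  · intro i hi
    simp only [hi, dif_pos]
    exact X.orderEmbOfFin_mem rfl _

/-- An increasing map on `I` maps the element of rank `k` to the element of rank `k` of its image. -/
theorem nth_image_count {I : Finset ℕ} {ψ : ℕ → ℕ} (hψ : StrictMonoOn ψ (I : Set ℕ)) {i : ℕ}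
    (hi : i ∈ I) : Nat.nth (· ∈ I.image ψ) (Nat.count (· ∈ I) i) = ψ i := by
  have hcount : Nat.count (· ∈ I) i = Nat.count (· ∈ I.image ψ) (ψ i) := by
    rw [Nat.count_eq_card_filter_range, Nat.count_eq_card_filter_range]
    refine Finset.card_bij (fun j _ => ψ j) ?_ ?_ ?_
    · intro j hj
      rw [Finset.mem_filter, Finset.mem_range] at hj ⊢
      exact ⟨hψ hj.2 hi hj.1, Finset.mem_image_of_mem ψ hj.2⟩
    · intro j hj k hk h
      exact hψ.injOn (Finset.mem_filter.1 hj).2 (Finset.mem_filter.1 hk).2 h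
    · intro b hb
      rw [Finset.mem_filter, Finset.mem_range] at hb
      obtain ⟨j, hj, rfl⟩ := Finset.mem_image.1 hb.2
      exact ⟨j, Finset.mem_filter.2 ⟨Finset.mem_range.2 ((hψ.lt_iff_lt hj hi).1 hb.1), hj⟩, rfl⟩
  rw [hcount]
  exact Nat.nth_count (p := (· ∈ I.image ψ)) (Finset.mem_image_of_mem ψ hi)

/-! ### Relabeling views -/

namespace View

variable {L L' L'' : Type*}

/-- The view obtained by replacing the identifiers by means of `f` and the labels by means of `l`. -/
def map (f : ℕ → ℕ) (l : L → L') (w : View L) : View L' where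
  center := f w.center
  nodes := Prod.map f l '' w.nodes
  edges := Sym2.map f '' w.edges

/-- All the identifiers that occur in the view (at the center, at nodes, or at ends of edges) are
in `I`. -/
def IdsIn (w : View L) (I : Set ℕ) : Prop :=
  w.center ∈ I ∧ (∀ p ∈ w.nodes, p.1 ∈ I) ∧ ∀ e ∈ w.edges, ∀ i ∈ e, i ∈ I

theorem map_map (f g : ℕ → ℕ) (l : L → L') (l' : L' → L'') (w : View L) :
    (w.map f l).map g l' = w.map (g ∘ f) (l' ∘ l) := by
  ext1
  · rfl
  · simp only [map, Set.image_image, Prod.map_map]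
  · simp only [map, Set.image_image, Sym2.map_map]

theorem map_congr {f g : ℕ → ℕ} {w : View L} {I : Set ℕ} (hw : w.IdsIn I) (h : ∀ i ∈ I, f i = g i)
    (l : L → L') : w.map f l = w.map g l := by
  ext1
  · exact h _ hw.1
  · exact Set.image_congr fun p hp => by rw [Prod.map, Prod.map, h _ (hw.2.1 p hp)]
  · exact Set.image_congr fun e he => Sym2.map_congr fun i hi => h i (hw.2.2 e he i hi)

theorem IdsIn.map {w : View L} {I J : Set ℕ} (hw : w.IdsIn I) {f : ℕ → ℕ}
    (hf : ∀ i ∈ I, f i ∈ J) (l : L → L') : (w.map f l).IdsIn J := by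
  refine ⟨hf _ hw.1, ?_, ?_⟩
  · rintro _ ⟨p, hp, rfl⟩
    exact hf _ (hw.2.1 p hp)
  · rintro _ ⟨e, he, rfl⟩ i hi
    obtain ⟨j, hj, rfl⟩ := Sym2.mem_map.1 hi
    exact hf _ (hw.2.2 e he j hj)

theorem finite_setOf_idsIn [Finite L] {I : Set ℕ} (hI : I.Finite) :
    {w : View L | w.IdsIn I}.Finite := by
  have hE : {e : Sym2 ℕ | ∀ i ∈ e, i ∈ I}.Finite := by
    refine ((hI.prod hI).image fun p : ℕ × ℕ => s(p.1, p.2)).subset fun e => ?_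
    induction e with
    | _ i j =>
      intro h
      exact ⟨(i, j), ⟨h i (Sym2.mem_mk_left i j), h j (Sym2.mem_mk_right i j)⟩, rfl⟩
  refine Set.Finite.of_injOn (f := fun w : View L => (w.center, w.nodes, w.edges))
    (t := I ×ˢ (𝒫 (I ×ˢ Set.univ) ×ˢ 𝒫 {e : Sym2 ℕ | ∀ i ∈ e, i ∈ I})) ?_ ?_
    (hI.prod ((hI.prod Set.finite_univ).finite_subsets.prod hE.finite_subsets))
  · exact fun w hw => ⟨hw.1, fun p hp => ⟨hw.2.1 p hp, trivial⟩, fun e he => hw.2.2 e he⟩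
  · intro w _ w' _ h
    simp only [Prod.mk.injEq] at h
    exact View.ext h.1 h.2.1 h.2.2

end View

/-- For every function `D` on views, there is a large set `X` of identifiers on which `D` is
order-invariant: `D` does not distinguish two order-preserving relabelings into `X` of the same
view. The bound `R` depends only on the numbers of labels and on the size of `X`. -/
theorem exists_orderInvariant (a b m : ℕ) :
    ∃ R : ℕ, ∀ (Lin : Type u) (Lout : Type v) [Finite Lin] [Finite Lout],
      Nat.card Lin = a → Nat.card Lout = b → ∀ S : Finset ℕ, R ≤ S.card →
      ∀ D : View Lin → Lout, ∃ X ⊆ S, X.card = m ∧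
        ∀ (w : View Lin) (I : Finset ℕ), w.IdsIn I → ∀ ψ φ : ℕ → ℕ,
          StrictMonoOn ψ (I : Set ℕ) → (∀ i ∈ I, ψ i ∈ X) →
          StrictMonoOn φ (I : Set ℕ) → (∀ i ∈ I, φ i ∈ X) →
          D (w.map ψ id) = D (w.map φ id) := by
  let P := {w : View (Fin a) // w.IdsIn (Set.Iio m)}
  have : Finite P := (View.finite_setOf_idsIn (Set.finite_Iio m)).to_subtype
  obtain ⟨R, hR⟩ := exists_color_eq_of_card_eq (P → Fin b) m
  refine ⟨R, fun Lin Lout _ _ ha hb S hS D => ?_⟩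
  let ein : Lin ≃ Fin a := Finite.equivFinOfCardEq ha
  let eout : Lout ≃ Fin b := Finite.equivFinOfCardEq hb
  obtain ⟨X, hXS, hX, hc⟩ := hR S hS fun A p => eout (D (p.1.map (Nat.nth (· ∈ A)) ein.symm))
  refine ⟨X, hXS, hX, fun w I hw ψ φ hψ hψX hφ hφX => ?_⟩
  have hψI : I.image ψ ⊆ X := Finset.image_subset_iff.2 hψX
  have hφI : I.image φ ⊆ X := Finset.image_subset_iff.2 hφX
  have hIm : I.card ≤ m := by
    rw [← Finset.card_image_of_injOn hψ.injOn, ← hX]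
    exact Finset.card_le_card hψI
  -- The pattern of `w`: every identifier is replaced by its rank in `I`.
  have hpat : (w.map (Nat.count (· ∈ I)) ein).IdsIn (Set.Iio m) := by
    refine hw.map (fun i hi => ?_) _
    rw [Set.mem_Iio, Nat.count_eq_card_filter_range]
    refine (Finset.card_lt_card (Finset.ssubset_iff_subset_ne.2 ⟨?_, ?_⟩)).trans_le hIm
    · exact fun j hj => (Finset.mem_filter.1 hj).2
    · intro h
      have := h.symm ▸ Finset.mem_coe.1 hi
      simp at this
  have hreal : ∀ χ : ℕ → ℕ, StrictMonoOn χ (I : Set ℕ) →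
      (w.map (Nat.count (· ∈ I)) ein).map (Nat.nth (· ∈ I.image χ)) ein.symm = w.map χ id := by
    intro χ hχ
    rw [View.map_map, ein.symm_comp_self]
    exact View.map_congr hw (fun i hi => nth_image_count hχ hi) _
  have h := congrFun (hc _ hψI _ hφI (by
    rw [Finset.card_image_of_injOn hψ.injOn, Finset.card_image_of_injOn hφ.injOn])) ⟨_, hpat⟩
  have h' := eout.injective h
  rwa [hreal ψ hψ, hreal φ hφ] at h'

/-! ### Balls and views in graphs -/

section Graph

variable {V : Type*} {L : Type*} {G : SimpleGraph V}

/-- A ball of radius `k` in a connected `d`-regular graph has at most `(d + 1) ^ k` nodes. -/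
theorem card_ball_le [Fintype V] {d : ℕ} (hG : G.Connected) (hd : G.IsRegularOfDegree d) (v : V)
    (k : ℕ) : (Finset.univ.filter fun a => G.dist v a ≤ k).card ≤ (d + 1) ^ k := by
  induction k with
  | zero =>
    rw [pow_zero, Finset.card_le_one]
    intro a ha b hb
    simp only [Finset.mem_filter, Finset.mem_univ, true_and, Nat.le_zero,
      hG.dist_eq_zero_iff] at ha hb
    rw [← ha, ← hb]
  | succ k ih =>
    have hsub : (Finset.univ.filter fun a => G.dist v a ≤ k + 1) ⊆
        (Finset.univ.filter fun a => G.dist v a ≤ k).biUnion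
          fun a => insert a (G.neighborFinset a) := by
      intro b hb
      simp only [Finset.mem_filter, Finset.mem_univ, true_and] at hb
      simp only [Finset.mem_biUnion, Finset.mem_filter, Finset.mem_univ, true_and,
        Finset.mem_insert, SimpleGraph.mem_neighborFinset]
      rcases Nat.lt_or_ge k (G.dist v b) with h | h
      · obtain ⟨p, hp⟩ := hG.exists_walk_length_eq_dist b v
        cases p with
        | nil => simp at h
        | cons hadj q =>
          rename_i c
          refine ⟨c, ?_, Or.inr hadj.symm⟩
          rw [SimpleGraph.Walk.length_cons, SimpleGraph.dist_comm] at hp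
          have := SimpleGraph.dist_le q
          rw [SimpleGraph.dist_comm]
          omega
      · exact ⟨b, h, Or.inl rfl⟩
    refine (Finset.card_le_card hsub).trans ((Finset.card_biUnion_le_card_mul _ _ (d + 1) ?_).trans ?_)
    · intro a _
      refine (Finset.card_insert_le _ _).trans ?_
      rw [SimpleGraph.card_neighborFinset_eq_degree, hd.degree_eq]
    · rw [pow_succ]
      exact Nat.mul_le_mul_right _ ih

theorem dist_le_of_adj {t : ℕ} (hG : G.Connected) {v a b : V} (hab : G.Adj a b)
    (h : G.dist v a < t) : G.dist v b ≤ t := by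
  have h₁ := hG.dist_triangle (u := v) (v := a) (w := b)
  rw [SimpleGraph.dist_eq_one_iff_adj.2 hab] at h₁
  omega

theorem idsIn_view (hG : G.Connected) (ident : V → ℕ) (x : V → L) (t : ℕ) (v : V) :
    (view G ident x t v).IdsIn (ident '' {a | G.dist v a ≤ t}) := by
  refine ⟨⟨v, by simp, rfl⟩, ?_, ?_⟩
  · rintro _ ⟨a, ha, rfl⟩
    exact ⟨a, ha, rfl⟩
  · rintro _ ⟨a, b, hab, ha, rfl⟩ i hi
    rcases Sym2.mem_iff.1 hi with rfl | rfl
    · exact ⟨a, ha.le, rfl⟩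
    · exact ⟨b, dist_le_of_adj hG hab ha, rfl⟩

/-- Replacing the identifiers of a ball replaces those of the view. -/
theorem view_eq_map (hG : G.Connected) {ident ident' : V → ℕ} (x : V → L) {t : ℕ} {v : V}
    {ψ : ℕ → ℕ} (h : ∀ a, G.dist v a ≤ t → ident' a = ψ (ident a)) :
    view G ident' x t v = (view G ident x t v).map ψ id := by
  ext1
  · exact h v (by simp)
  · ext p
    constructor
    · rintro ⟨a, ha, rfl⟩
      exact ⟨_, ⟨a, ha, rfl⟩, by rw [h a ha]; rfl⟩
    · rintro ⟨_, ⟨a, ha, rfl⟩, rfl⟩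
      exact ⟨a, ha, by rw [h a ha]; rfl⟩
  · ext e
    constructor
    · rintro ⟨a, b, hab, ha, rfl⟩
      exact ⟨_, ⟨a, b, hab, ha, rfl⟩, by
        rw [h a ha.le, h b (dist_le_of_adj hG hab ha), Sym2.map_mk]⟩
    · rintro ⟨_, ⟨a, b, hab, ha, rfl⟩, rfl⟩
      exact ⟨a, b, hab, ha, by
        rw [h a ha.le, h b (dist_le_of_adj hG hab ha), Sym2.map_mk]⟩

/-- The views of the nodes of a star lie in the ball of radius `t + 1` around its center. -/
theorem IsStar.dist_le {d t : ℕ} (hG : G.Connected) {v : Fin (d + 1) → V} (hv : IsStar G v)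
    (i : Fin (d + 1)) {a : V} (ha : G.dist (v i) a ≤ t) : G.dist (v 0) a ≤ t + 1 := by
  refine Fin.cases (fun ha => by omega) (fun j ha => ?_) i ha
  have h₁ := hG.dist_triangle (u := v 0) (v := v j.succ) (w := a)
  rw [SimpleGraph.dist_eq_one_iff_adj.2 (hv.2 j)] at h₁
  omega

end Graph

/-! ### Facets -/

section Facets

variable {d : ℕ} {α β : Type*}

theorem mem_named {x : Fin (d + 1) → α} {p : Fin (d + 1) × α} : p ∈ named x ↔ p.2 = x p.1 := by
  obtain ⟨i, y⟩ := p
  simp only [named, Finset.mem_image, Finset.mem_univ, true_and, Prod.mk.injEq]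
  constructor
  · rintro ⟨j, rfl, rfl⟩
    rfl
  · rintro rfl
    exact ⟨i, rfl, rfl⟩

theorem named_nonempty (x : Fin (d + 1) → α) : (named x).Nonempty :=
  ⟨(0, x 0), mem_named.2 rfl⟩

theorem eq_of_named_subset {x y : Fin (d + 1) → α} (h : named x ⊆ named y) : x = y :=
  funext fun i => mem_named.1 (h (mem_named.2 (rfl : ((i, x i) : Fin (d + 1) × α).2 = x i)))

theorem named_image (x : Fin (d + 1) → α) (f : Fin (d + 1) × α → Fin (d + 1) × β)
    (y : Fin (d + 1) → β) (h : ∀ i, f (i, x i) = (i, y i)) : (named x).image f = named y := by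
  ext p
  rw [Finset.mem_image, mem_named]
  constructor
  · rintro ⟨⟨i, z⟩, hz, rfl⟩
    obtain rfl : z = x i := mem_named.1 hz
    rw [h i]
  · obtain ⟨i, z⟩ := p
    intro hz
    obtain rfl : z = y i := hz
    exact ⟨(i, x i), mem_named.2 rfl, h i⟩

/-- The image in the definition of simplicial maps may be taken with any decidable equality. -/
theorem isSimplicial_iff {α β : Type*} [inst : DecidableEq β] {K : PreAbstractSimplicialComplex α}
    {L : PreAbstractSimplicialComplex β} {f : α → β} :
    IsSimplicial K L f ↔ ∀ s ∈ K.faces, s.image f ∈ L.faces := by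
  rw [Subsingleton.elim inst fun a b => Classical.propDecidable (a = b)]
  rfl

theorem mem_facets_generated {𝓕 : Set (Finset (Fin (d + 1) × α))}
    (h𝓕 : ∀ F ∈ 𝓕, ∃ x, F = named x) {F : Finset (Fin (d + 1) × α)} :
    F ∈ facets (generated 𝓕) ↔ F ∈ 𝓕 := by
  constructor
  · rintro ⟨⟨-, F', hF', hFF'⟩, hmax⟩
    obtain ⟨x, rfl⟩ := h𝓕 F' hF'
    have : named x ⊆ F := hmax ⟨named_nonempty x, _, hF', subset_rfl⟩ hFF'
    rwa [hFF'.antisymm this]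
  · intro hF
    obtain ⟨x, rfl⟩ := h𝓕 F hF
    refine ⟨⟨named_nonempty x, _, hF, subset_rfl⟩, ?_⟩
    rintro s ⟨-, F', hF', hsF'⟩ hs
    obtain ⟨y, rfl⟩ := h𝓕 F' hF'
    rw [eq_of_named_subset (hs.trans hsF')]
    exact hsF'

variable {Lin : Type u} {Lout : Type v} (T : LCLTask d Lin Lout)

theorem mem_facets_inputComplexWithIds {X : Finset ℕ} {F : Finset (Fin (d + 1) × (ℕ × Lin))} :
    F ∈ facets (T.inputComplexWithIds X) ↔ ∃ y : Fin (d + 1) → ℕ × Lin,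
      Function.Injective (fun i => (y i).1) ∧ (∀ i, (y i).1 ∈ X) ∧
      starOf (fun i => (y i).2) ∈ T.Sin ∧ F = named y :=
  mem_facets_generated (by rintro _ ⟨y, -, -, -, h⟩; exact ⟨y, h⟩)

theorem mem_facets_protocolComplex {𝒢 : Set (Σ n : ℕ, SimpleGraph (Fin n))} {t : ℕ} {X : Finset ℕ}
    {F : Finset (Fin (d + 1) × View Lin)} :
    F ∈ facets (T.protocolComplex 𝒢 t X) ↔ ∃ w : Fin (d + 1) → View Lin,
      MutuallyCompatible 𝒢 T.Sin t w ∧ (∀ i, ∀ p ∈ (w i).nodes, p.1 ∈ X) ∧ F = named w :=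
  mem_facets_generated (by rintro _ ⟨w, -, -, h⟩; exact ⟨w, h⟩)

end Facets

/-! ### From algorithms to decision maps -/

theorem hasDecisionMap_of_solvableInLOCAL {d t : ℕ} {Lin : Type u} {Lout : Type v}
    {𝒢 : Set (Σ n : ℕ, SimpleGraph (Fin n))} {T : LCLTask d Lin Lout}
    (h : SolvableInLOCAL 𝒢 T t) (X : Finset ℕ) : HasDecisionMap 𝒢 T t X := by
  obtain ⟨alg, halg⟩ := h
  have himage (w : Fin (d + 1) → View Lin) :
      (named w).image (fun p => (p.1, alg p.2)) = named fun i => alg (w i) :=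
    named_image _ _ _ fun _ => rfl
  refine ⟨fun p => (p.1, alg p.2), isSimplicial_iff.2 ?_, fun _ _ _ => rfl, fun _ _ _ _ _ => rfl, ?_⟩
  · rintro s ⟨hs, _, ⟨w, ⟨G, hG, ident, x, v, hid, hx, hv, hw⟩, -, rfl⟩, hsw⟩
    refine ⟨hs.image _, named fun i => alg (w i), ⟨fun i => alg (w i), ?_, rfl⟩,
      (Finset.image_subset_image hsw).trans (himage w).subset⟩
    rw [funext hw]
    exact (halg G hG ident x hid hx).1 v hv
  · rintro F hF _ ⟨F', ⟨hF', hΞ⟩, rfl⟩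
    obtain ⟨w, ⟨G, hG, ident, x, v, hid, hx, hv, hw⟩, -, rfl⟩ :=
      (mem_facets_protocolComplex T).1 hF'
    obtain ⟨y, -, -, -, rfl⟩ := (mem_facets_inputComplexWithIds T).1 hF
    have hy : ∀ i, (y i).2 = x (v i) := by
      intro i
      obtain ⟨w', hw', hcenter, hnode⟩ := hΞ i (y i) (mem_named.2 rfl)
      obtain rfl : w' = w i := mem_named.1 hw'
      rw [hw i] at hcenter hnode
      obtain ⟨a, -, ha⟩ := hnode
      have : v i = a := hid.1 (hcenter.trans (by rw [ha]))
      rw [ha, this]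
    change (named w).image _ ∈ _
    rw [himage w, named_image y forgetIds (x ∘ v) fun i => by rw [forgetIds, hy i]; rfl]
    rw [funext hw]
    exact (halg G hG ident x hid hx).2 v hv

/-! ### From decision maps to algorithms -/

/-- A decision map for identifiers in `X` amounts to a function on views. -/
theorem HasDecisionMap.exists_fun {d t : ℕ} {Lin : Type u} {Lout : Type v}
    {𝒢 : Set (Σ n : ℕ, SimpleGraph (Fin n))} {T : LCLTask d Lin Lout} {X : Finset ℕ}
    (h : HasDecisionMap 𝒢 T t X) :
    ∃ D : View Lin → Lout, ∀ w : Fin (d + 1) → View Lin, named w ∈ facets (T.protocolComplex 𝒢 t X) →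
      starOf (fun i => D (w i)) ∈ T.Sout ∧
      ∀ F ∈ facets (T.inputComplexWithIds X), named w ∈ T.Ξ 𝒢 t X F →
        named (fun i => D (w i)) ∈ T.Δ (F.image forgetIds) := by
  obtain ⟨δ, hsimp, hname, hind, hδ⟩ := h
  -- At a view that is not a vertex of the complex under any name, the value of `D` is irrelevant.
  let D : View Lin → Lout := fun w =>
    if h : ∃ i, {(i, w)} ∈ (T.protocolComplex 𝒢 t X).faces then (δ (h.choose, w)).2
    else (δ (0, w)).2
  have hD : ∀ i w, {(i, w)} ∈ (T.protocolComplex 𝒢 t X).faces → δ (i, w) = (i, D w) := by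
    intro i w hw
    have hex : ∃ i, {(i, w)} ∈ (T.protocolComplex 𝒢 t X).faces := ⟨i, hw⟩
    refine Prod.ext (hname i w hw) ?_
    simp only [D, dif_pos hex]
    exact hind _ _ _ hw hex.choose_spec
  refine ⟨D, fun w hw => ?_⟩
  have himage : (named w).image δ = named fun i => D (w i) := by
    refine named_image _ _ _ fun i => hD i (w i) ?_
    obtain ⟨-, F, hF, hwF⟩ := hw.1
    exact ⟨Finset.singleton_nonempty _, F, hF,
      Finset.singleton_subset_iff.2 (hwF (mem_named.2 rfl))⟩
  constructor
  · obtain ⟨-, _, ⟨z, hz, rfl⟩, hsub⟩ := isSimplicial_iff.1 hsimp _ hw.1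
    rw [himage] at hsub
    rwa [eq_of_named_subset hsub]
  · intro F hF hΞ
    have h := hδ F hF ⟨_, hΞ, rfl⟩
    change (named w).image δ ∈ _ at h
    rwa [himage] at h

/-- If the value of a decision function on views with identifiers in a large set `X` depends only on
their order, then the views with arbitrary identifiers can be relabeled into `X`. -/
theorem solvableInLOCAL_of_orderInvariant {d t R : ℕ} {Lin : Type u} {Lout : Type v}
    {𝒢 : Set (Σ n : ℕ, SimpleGraph (Fin n))} (h𝒢 : 𝒢 ⊆ regularGraphs d)
    {T : LCLTask d Lin Lout} {D : View Lin → Lout}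
    (hD : ∀ w : Fin (d + 1) → View Lin,
      named w ∈ facets (T.protocolComplex 𝒢 t (Finset.Icc 1 R)) →
      starOf (fun i => D (w i)) ∈ T.Sout ∧
      ∀ F ∈ facets (T.inputComplexWithIds (Finset.Icc 1 R)),
        named w ∈ T.Ξ 𝒢 t (Finset.Icc 1 R) F → named (fun i => D (w i)) ∈ T.Δ (F.image forgetIds))
    {X : Finset ℕ} (hXR : X ⊆ Finset.Icc 1 R) (hX : (d + 1) ^ (t + 1) ≤ X.card)
    (hinv : ∀ (w : View Lin) (I : Finset ℕ), w.IdsIn I → ∀ ψ φ : ℕ → ℕ,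
      StrictMonoOn ψ (I : Set ℕ) → (∀ i ∈ I, ψ i ∈ X) →
      StrictMonoOn φ (I : Set ℕ) → (∀ i ∈ I, φ i ∈ X) → D (w.map ψ id) = D (w.map φ id)) :
    SolvableInLOCAL 𝒢 T t := by
  let alg : View Lin → Lout := fun w =>
    if h : ∃ ψ : ℕ → ℕ, StrictMonoOn ψ (Prod.fst '' w.nodes) ∧ ∀ i ∈ Prod.fst '' w.nodes, ψ i ∈ X
    then D (w.map h.choose id) else D w
  suffices key : ∀ G ∈ 𝒢, ∀ (ident : Fin G.1 → ℕ) (x : Fin G.1 → Lin),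
      IsIdAssignment ident → StarsIn G.2 T.Sin x → ∀ v : Fin (d + 1) → Fin G.1, IsStar G.2 v →
        starOf (fun i => alg (view G.2 ident x t (v i))) ∈ T.Sout ∧
        named (fun i => alg (view G.2 ident x t (v i))) ∈ T.Δ (named (x ∘ v)) from
    ⟨alg, fun G hG ident x hid hx => ⟨fun v hv => (key G hG ident x hid hx v hv).1,
      fun v hv => (key G hG ident x hid hx v hv).2⟩⟩
  intro G hG ident x hid hx v hv
  obtain ⟨hconn, hreg⟩ := h𝒢 hG
  obtain ⟨ψ, hψ, hψX⟩ := exists_strictMonoOn_mapsTo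
    ((Finset.univ.filter fun a => G.2.dist (v 0) a ≤ t + 1).image ident) X
    (Finset.card_image_le.trans ((card_ball_le hconn hreg (v 0) (t + 1)).trans hX))
  have hball : ∀ a, G.2.dist (v 0) a ≤ t + 1 →
      ident a ∈ (Finset.univ.filter fun a => G.2.dist (v 0) a ≤ t + 1).image ident := fun a ha =>
    Finset.mem_image_of_mem _ (Finset.mem_filter.2 ⟨Finset.mem_univ _, ha⟩)
  have hψR : ∀ a, G.2.dist (v 0) a ≤ t + 1 → ψ (ident a) ∈ Finset.Icc 1 R := fun a ha =>
    hXR (hψX _ (hball a ha))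
  -- The new identifiers: those of the ball around the star are in `X`, the others are beyond `R`.
  let ident' : Fin G.1 → ℕ := fun a =>
    if G.2.dist (v 0) a ≤ t + 1 then ψ (ident a) else R + ident a
  have hin : ∀ a, G.2.dist (v 0) a ≤ t + 1 → ident' a = ψ (ident a) := fun a ha => if_pos ha
  have hout : ∀ a, ¬ G.2.dist (v 0) a ≤ t + 1 → ident' a = R + ident a := fun a ha => if_neg ha
  have hid' : IsIdAssignment ident' := by
    constructor
    · intro a b hab
      by_cases ha : G.2.dist (v 0) a ≤ t + 1 <;> by_cases hb : G.2.dist (v 0) b ≤ t + 1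
      · rw [hin a ha, hin b hb] at hab
        exact hid.1 (hψ.injOn (hball a ha) (hball b hb) hab)
      · rw [hin a ha, hout b hb] at hab
        have h₁ := (Finset.mem_Icc.1 (hψR a ha)).2
        have h₂ := hid.2 b
        omega
      · rw [hout a ha, hin b hb] at hab
        have h₁ := (Finset.mem_Icc.1 (hψR b hb)).2
        have h₂ := hid.2 a
        omega
      · rw [hout a ha, hout b hb] at hab
        exact hid.1 (by omega)
    · intro a
      by_cases ha : G.2.dist (v 0) a ≤ t + 1
      · rw [hin a ha]
        exact (Finset.mem_Icc.1 (hψR a ha)).1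
      · rw [hout a ha]
        exact (hid.2 a).trans (Nat.le_add_left _ _)
  -- On the original views, the algorithm has the values of `D` on the new views.
  have halg : ∀ i, alg (view G.2 ident x t (v i)) = D (view G.2 ident' x t (v i)) := by
    intro i
    let I := (Finset.univ.filter fun a => G.2.dist (v i) a ≤ t).image ident
    have hIcoe : (I : Set ℕ) = ident '' {a | G.2.dist (v i) a ≤ t} := by simp [I]
    have hInodes : Prod.fst '' (view G.2 ident x t (v i)).nodes = (I : Set ℕ) := by
      rw [hIcoe]
      ext k
      constructor
      · rintro ⟨_, ⟨a, ha, rfl⟩, rfl⟩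
        exact ⟨a, ha, rfl⟩
      · rintro ⟨a, ha, rfl⟩
        exact ⟨_, ⟨a, ha, rfl⟩, rfl⟩
    have hsub : ∀ k ∈ I, k ∈ (Finset.univ.filter fun a => G.2.dist (v 0) a ≤ t + 1).image ident := by
      intro k hk
      obtain ⟨a, ha, rfl⟩ := Finset.mem_image.1 hk
      exact hball a (hv.dist_le hconn i (Finset.mem_filter.1 ha).2)
    have hψI : StrictMonoOn ψ (I : Set ℕ) := hψ.mono fun k hk => hsub k hk
    have hex : ∃ φ : ℕ → ℕ, StrictMonoOn φ (Prod.fst '' (view G.2 ident x t (v i)).nodes) ∧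
        ∀ k ∈ Prod.fst '' (view G.2 ident x t (v i)).nodes, φ k ∈ X := by
      rw [hInodes]
      exact ⟨ψ, hψI, fun k hk => hψX k (hsub k hk)⟩
    have hspec := hex.choose_spec
    rw [view_eq_map hconn x fun a ha => hin a (hv.dist_le hconn i ha)]
    simp only [alg, dif_pos hex]
    refine hinv _ I (hIcoe ▸ idsIn_view hconn ident x t (v i)) _ _ ?_ ?_ hψI
      fun k hk => hψX k (hsub k hk)
    · exact hInodes ▸ hspec.1
    · exact fun k hk => hspec.2 k (hInodes.symm ▸ hk)
  have hcenter : ∀ i, G.2.dist (v 0) (v i) ≤ t + 1 := fun i => hv.dist_le hconn i (by simp)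
  have hfacet : named (fun i => view G.2 ident' x t (v i)) ∈
      facets (T.protocolComplex 𝒢 t (Finset.Icc 1 R)) := by
    refine (mem_facets_protocolComplex T).2
      ⟨_, ⟨G, hG, ident', x, v, hid', hx, hv, fun _ => rfl⟩, ?_, rfl⟩
    rintro i _ ⟨a, ha, rfl⟩
    have ha' := hv.dist_le hconn i ha
    exact (hin a ha').symm ▸ hψR a ha'
  obtain ⟨hstar, hΔ⟩ := hD _ hfacet
  simp only [halg]
  refine ⟨hstar, ?_⟩
  have hF : named (fun i => (ident' (v i), x (v i))) ∈
      facets (T.inputComplexWithIds (Finset.Icc 1 R)) := by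
    refine (mem_facets_inputComplexWithIds T).2
      ⟨_, fun i j h => hv.1 (hid'.1 h), fun i => ?_, hx v hv, rfl⟩
    exact (hin _ (hcenter i)).symm ▸ hψR _ (hcenter i)
  have := hΔ _ hF ⟨hfacet, fun i y hy => ⟨view G.2 ident' x t (v i), mem_named.2 rfl, ?_, ?_⟩⟩
  · rwa [named_image _ forgetIds (x ∘ v) fun i => rfl] at this
  · obtain rfl : y = (ident' (v i), x (v i)) := mem_named.1 hy
    rfl
  · obtain rfl : y = (ident' (v i), x (v i)) := mem_named.1 hy
    exact ⟨v i, by simp, rfl⟩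

end LocalLCL

theorem theorem2 (d t : ℕ) (hd : 2 ≤ d) :
    (∀ (Lin : Type u) (Lout : Type v) [Finite Lin] [Finite Lout]
        (𝒢 : Set (Σ n : ℕ, SimpleGraph (Fin n))), 𝒢 ⊆ regularGraphs d →
        ∀ T : LCLTask d Lin Lout, SolvableInLOCAL 𝒢 T t →
          ∀ R : ℕ, ballBound d (t + 1) ≤ R → HasDecisionMap 𝒢 T t (Finset.Icc 1 R)) ∧
    (∀ a b : ℕ, ∃ R : ℕ, ballBound d (t + 1) ≤ R ∧
        ∀ (Lin : Type u) (Lout : Type v) [Finite Lin] [Finite Lout],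
          Nat.card Lin = a → Nat.card Lout = b →
          ∀ 𝒢 : Set (Σ n : ℕ, SimpleGraph (Fin n)), 𝒢 ⊆ regularGraphs d →
          ∀ T : LCLTask d Lin Lout, HasDecisionMap 𝒢 T t (Finset.Icc 1 R) →
            SolvableInLOCAL 𝒢 T t) := by
  refine ⟨fun Lin Lout _ _ 𝒢 _ T h R _ => hasDecisionMap_of_solvableInLOCAL h _, fun a b => ?_⟩
  obtain ⟨R, hR⟩ := exists_orderInvariant.{u, v} a b ((d + 1) ^ (t + 1))
  refine ⟨max R (ballBound d (t + 1)), le_max_right _ _, fun Lin Lout _ _ ha hb 𝒢 h𝒢 T h => ?_⟩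
  obtain ⟨D, hD⟩ := h.exists_fun
  obtain ⟨X, hXR, hX, hinv⟩ := hR Lin Lout ha hb (Finset.Icc 1 (max R (ballBound d (t + 1))))
    (by rw [Nat.card_Icc]; omega) D
  exact solvableInLOCAL_of_orderInvariant h𝒢 hD hXR hX.ge hinv
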